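/- For $V\subset\mathbb R^3$ let $\mathcal B(V)=\{y\in\mathbb R^3:\|y-v\|\le 1\text{ for all }v\in V\}$, and let $\mathrm{cr}(V)$ be the circumradius of $V$ (the smallest radius of a closed ball that includes $V$). A finite set $V$ with $\mathrm{cr}(V)<1$ is called tight if $\mathcal B(V)\subsetneq\mathcal B(V\setminus\{v\})$ for every $v\in V$. For $p\in V$ the facet $F_p$ of $\mathcal B(V)$ is $\{x\in\mathcal B(V):\|x-p\|=1\}$. A vertex of $\mathcal B(V)$ is a point of $\mathcal B(V)$ that belongs to $F_p$ for at least three points $p\in V$, or a point of $V\cap\mathcal B(V)$ that belongs to $F_p$ for exactly two points $p\in V$; the set of vertices is denoted $\mathrm{vert}\,\mathcal B(V)$. An edge of $\mathcal B(V)$ is the closure of a connected component of $(F_p\cap F_q)\setminus\mathrm{vert}\,\mathcal B(V)$, where $p,q$ are distinct points of $V$. The $1$-skeleton of $\mathcal B(V)$ is the (multi)graph whose vertices and edges are the vertices and edges of $\mathcal B(V)$, an edge joining the vertices of $\mathcal B(V)$ that lie on it. Corollary 6.1. Let $V\subset\mathbb R^3$ be finite and tight, with $\#V\ge 3$ and $\mathrm{cr}(V)<1$.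 Then for every vertex $x$ of $\mathcal B(V)$, the valence of $x$ in the $1$-skeleton of $\mathcal B(V)$ equals the number of points of $V$ at distance exactly $1$ from $x$. -/

import Mathlib

namespace BallPolytope

/-- Euclidean `3`-space with the Euclidean norm. -/
abbrev E3 : Type := EuclideanSpace ℝ (Fin 3)

/-- The circumradius `cr(W)`: the infimum (attained, for bounded `W`) of the radii of the closed
balls that include `W`. It is only used for finite `W`. -/
noncomputable def circumradius (W : Set E3) : ℝ :=
  sInf {r : ℝ | 0 ≤ r ∧ ∃ c : E3, W ⊆ Metric.closedBall c r}

/-- The ball set `B(V)`: the points at distance at most `1` from every point of `V`. -/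
def ballSet (V : Set E3) : Set E3 := {y | ∀ v ∈ V, dist y v ≤ 1}

/-- The set of essential points of `V`: the points `v ∈ V` whose removal from `V` strictly
enlarges the ball set. -/
def ess (V : Set E3) : Set E3 := {v | v ∈ V ∧ ballSet V ⊂ ballSet (V \ {v})}

/-- A finite set of circumradius less than `1` is tight if all its points are essential. -/
structure IsTight (V : Set E3) : Prop where
  finite : V.Finite
  circumradius_lt_one : circumradius V < 1
  eq_ess : V = ess V

/-- The facet `F_p` of `B(V)` (for `p ∈ V`). -/
def facet (V : Set E3) (p : E3) : Set E3 := {x | x ∈ ballSet V ∧ dist x p = 1}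

/-- The principal vertices of `B(V)`: the points that lie on at least three of the facets `F_p`,
`p ∈ V`. -/
def principalVertices (V : Set E3) : Set E3 :=
  {z | 3 ≤ {p | p ∈ V ∧ z ∈ facet V p}.encard}

/-- The dangling vertices of `B(V)`: the points of `V ∩ B(V)` that lie on exactly two of the
facets `F_p`, `p ∈ V`. -/
def danglingVertices (V : Set E3) : Set E3 :=
  {z | z ∈ V ∩ ballSet V ∧ {p | p ∈ V ∧ z ∈ facet V p}.encard = 2}

/-- The set `vert B(V)` of vertices of `B(V)`. -/
def vert (V : Set E3) : Set E3 := principalVertices V ∪ danglingVertices V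

/-- The edges of `B(V)`: the closures of the connected components of `(F_p ∩ F_q) \ vert B(V)`,
where `p`, `q` range over all pairs of distinct points of `V`. -/
def IsEdge (V : Set E3) (e : Set E3) : Prop :=
  ∃ p ∈ V, ∃ q ∈ V, p ≠ q ∧ ∃ z ∈ (facet V p ∩ facet V q) \ vert V,
    e = closure (connectedComponentIn ((facet V p ∩ facet V q) \ vert V) z)

/-- The `1`-skeleton of `B(V)`, as a multigraph: its vertices are the vertices of `B(V)`, its edges
are the edges of `B(V)` (as subsets of space, so that different arcs with the same two endpoints are
different parallel edges), and an edge joins `x` and `y` when `x`, `y` are the vertices of `B(V)`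
on it (`x = y` is a loop). -/
def oneSkeleton (V : Set E3) : Graph E3 (Set E3) where
  vertexSet := vert V
  IsLink e x y := IsEdge V e ∧ e ∩ vert V = {x, y}
  isLink_symm := fun _ _ => ⟨fun x y h => ⟨h.1, by rw [h.2, Set.pair_comm]⟩⟩
  eq_or_eq_of_isLink_of_isLink := by
    rintro e x y v w ⟨-, h⟩ ⟨-, h'⟩
    have hx : x ∈ ({v, w} : Set E3) := by
      rw [← h', h]
      exact Set.mem_insert x {y}
    simpa using hx
  left_mem_of_isLink := by
    rintro e x y ⟨-, h⟩
    have hx : x ∈ e ∩ vert V := by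
      rw [h]
      exact Set.mem_insert x {y}
    exact hx.2

/-- The valence of a vertex of a multigraph: the number of edges incident with it, loops being
counted twice. -/
noncomputable def valence {α β : Type*} (G : Graph α β) (x : α) : ℕ∞ :=
  (G.incidenceSet x).encard + (G.loopSet x).encard

end BallPolytope

/-! Put `x` at the origin and invert in the unit sphere around it. For a point `p` of `V` at
distance 1 from `x`, the unit ball around `p` becomes the half-space `⟪w, p - x⟫ ≥ 1 / 2`. The
circle belonging to two such points becomes a line in the direction of their cross product, and
approaching `x` means going to infinity. So the edges leaving `x` are read off from the signs of
determinants.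

Since `cr(V) < 1`, the touching directions `p - x` lie in an open half-space (`exists_inner_pos`);
by tightness each of them spans an extreme ray of their cone (`exists_support`). The rays of such a
cone are cyclically ordered, and every `p` has exactly one successor `q` (`exists_isGerm`,
`IsGerm.right_unique`). Such a pair, a germ, starts one edge at `x`, every edge at `x` arises so
(`exists_isGermEdge`), and the edge determines `p` (`IsGermEdge.left_unique`). Hence edges at `x`
correspond to touching points.

Loops remain to be excluded: no circle returns to `x` without meeting another vertex
(`exists_arc_notMem_openEdge`). With only two touching points this is where dangling vertices
matter. -/

namespace BallPolytope

open Filter Topology Set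

/-! ### Vector algebra in `E3` -/

/-- The cross product of two vectors of `E3`. -/
noncomputable def cross (a b : E3) : E3 :=
  !₂[a 1 * b 2 - a 2 * b 1, a 2 * b 0 - a 0 * b 2, a 0 * b 1 - a 1 * b 0]

/-- The determinant of three vectors of `E3`. -/
noncomputable def det3 (a b c : E3) : ℝ := inner ℝ (cross a b) c

theorem inner_eq_sum (a b : E3) : inner ℝ a b = a 0 * b 0 + a 1 * b 1 + a 2 * b 2 := by
  simp [PiLp.inner_apply, Fin.sum_univ_three, mul_comm]

theorem cross_zero (a b : E3) : cross a b 0 = a 1 * b 2 - a 2 * b 1 := rfl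

theorem cross_one (a b : E3) : cross a b 1 = a 2 * b 0 - a 0 * b 2 := rfl

theorem cross_two (a b : E3) : cross a b 2 = a 0 * b 1 - a 1 * b 0 := rfl

theorem det3_eq (a b c : E3) : det3 a b c =
    (a 1 * b 2 - a 2 * b 1) * c 0 + (a 2 * b 0 - a 0 * b 2) * c 1 +
      (a 0 * b 1 - a 1 * b 0) * c 2 := by
  simp [det3, inner_eq_sum, cross]

theorem cross_swap (a b : E3) : cross b a = -cross a b := by
  ext i
  fin_cases i <;> simp [cross] <;> ring

theorem inner_cross_left (a b : E3) : inner ℝ (cross a b) a = 0 := by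
  simp only [inner_eq_sum, cross_zero, cross_one, cross_two]; ring

theorem inner_cross_right (a b : E3) : inner ℝ (cross a b) b = 0 := by
  simp only [inner_eq_sum, cross_zero, cross_one, cross_two]; ring

theorem inner_cross_self (a b : E3) : inner ℝ (cross a b) (cross a b) =
    inner ℝ a a * inner ℝ b b - inner ℝ a b ^ 2 := by
  simp only [inner_eq_sum, cross_zero, cross_one, cross_two]; ring

/-- A vector orthogonal to `a` and `b` is a multiple of their cross product. -/
theorem smul_cross_eq_of_orthogonal {a b v : E3} (ha : inner ℝ v a = 0) (hb : inner ℝ v b = 0) :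
    inner ℝ (cross a b) (cross a b) • v = inner ℝ v (cross a b) • cross a b := by
  rw [inner_eq_sum] at ha hb
  ext i
  fin_cases i <;>
    simp only [inner_eq_sum, PiLp.smul_apply, smul_eq_mul, Fin.zero_eta, Fin.mk_one,
      Fin.reduceFinMk, cross_zero, cross_one, cross_two]
  · linear_combination (((a 2 * b 0 - a 0 * b 2) * a 2 - (a 0 * b 1 - a 1 * b 0) * a 1) * hb -
      ((a 2 * b 0 - a 0 * b 2) * b 2 - (a 0 * b 1 - a 1 * b 0) * b 1) * ha)
  · linear_combination (((a 0 * b 1 - a 1 * b 0) * a 0 - (a 1 * b 2 - a 2 * b 1) * a 2) * hb -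
      ((a 0 * b 1 - a 1 * b 0) * b 0 - (a 1 * b 2 - a 2 * b 1) * b 2) * ha)
  · linear_combination (((a 1 * b 2 - a 2 * b 1) * a 1 - (a 2 * b 0 - a 0 * b 2) * a 0) * hb -
      ((a 1 * b 2 - a 2 * b 1) * b 1 - (a 2 * b 0 - a 0 * b 2) * b 0) * ha)

theorem det3_swap_right (a b c : E3) : det3 a c b = -det3 a b c := by
  simp only [det3_eq]; ring

/-- The Plücker relation for a functional that vanishes on `a`. -/
theorem det3_pluecker {e a : E3} (he : inner ℝ e a = 0) (b c d : E3) :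
    det3 a b c * inner ℝ e d + det3 a c d * inner ℝ e b + det3 a d b * inner ℝ e c = 0 := by
  rw [inner_eq_sum] at he
  simp only [det3_eq, inner_eq_sum]
  linear_combination ((b 1 * c 2 - b 2 * c 1) * d 0 + (b 2 * c 0 - b 0 * c 2) * d 1 +
    (b 0 * c 1 - b 1 * c 0) * d 2) * he

/-- Modulo `a`, the vectors on which `e` is positive fill an open half-plane, where the sign of
`det3 a` compares angles. -/
theorem det3_trans {e a b c d : E3} (he : inner ℝ e a = 0) (hb : 0 < inner ℝ e b)
    (hc : 0 < inner ℝ e c) (hd : 0 < inner ℝ e d) (hbc : 0 < det3 a b c) (hcd : 0 < det3 a c d) :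
    0 < det3 a b d := by
  have h := det3_pluecker he b c d
  rw [det3_swap_right a b d] at h
  have h1 := mul_pos hbc hd
  have h2 := mul_pos hcd hb
  by_contra! h3
  nlinarith [mul_nonneg (neg_nonneg.2 h3) hc.le]

/-- The expansion of a vector in the basis formed by `a`, `b` and their cross product. -/
theorem inner_cross_self_mul_inner (a b c e : E3) :
    inner ℝ (cross a b) (cross a b) * inner ℝ e c =
      inner ℝ (cross c b) (cross a b) * inner ℝ e a +
        inner ℝ (cross a c) (cross a b) * inner ℝ e b +
          det3 a b c * inner ℝ e (cross a b) := by
  simp only [det3_eq, inner_eq_sum, cross_zero, cross_one, cross_two]; ring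

/-- Three vectors none of which lies on a side of the cone of the other two are independent. -/
theorem det3_ne_zero {a b c e f g : E3} (hab : 0 < inner ℝ (cross a b) (cross a b))
    (hea : inner ℝ e a = 0) (heb : 0 < inner ℝ e b) (hec : 0 < inner ℝ e c)
    (hfb : inner ℝ f b = 0) (hfa : 0 < inner ℝ f a) (hfc : 0 < inner ℝ f c)
    (hgc : inner ℝ g c = 0) (hga : 0 < inner ℝ g a) (hgb : 0 < inner ℝ g b) :
    det3 a b c ≠ 0 := by
  intro h
  have h1 := inner_cross_self_mul_inner a b c e
  have h2 := inner_cross_self_mul_inner a b c f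
  have h3 := inner_cross_self_mul_inner a b c g
  rw [h, hea] at h1
  rw [h, hfb] at h2
  rw [h, hgc] at h3
  simp only [mul_zero, zero_mul, add_zero, zero_add] at h1 h2 h3
  -- Dependence would make `c` a combination of `a` and `b`, with positive coefficients by `e` and
  -- `f`; but `g` vanishes on `c` and is positive on `a` and `b`.
  have hβ : 0 < inner ℝ (cross a c) (cross a b) :=
    pos_of_mul_pos_left (h1 ▸ mul_pos hab hec) heb.le
  have hα : 0 < inner ℝ (cross c b) (cross a b) :=
    pos_of_mul_pos_left (h2 ▸ mul_pos hab hfc) hfa.le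
  have := mul_pos hα hga
  have := mul_pos hβ hgb
  linarith

/-! ### Inversion in the unit sphere -/

/-- Inversion in the unit sphere around the origin. -/
noncomputable def invert (w : E3) : E3 := (‖w‖ ^ 2)⁻¹ • w

theorem norm_invert (w : E3) : ‖invert w‖ = ‖w‖⁻¹ := by
  rcases eq_or_ne w 0 with rfl | hw
  · simp [invert]
  · have : ‖w‖ ≠ 0 := norm_ne_zero_iff.2 hw
    rw [invert, norm_smul, norm_inv, norm_pow, norm_norm]
    field_simp

theorem invert_invert (w : E3) : invert (invert w) = w := by
  rcases eq_or_ne w 0 with rfl | hw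
  · simp [invert]
  · have : ‖w‖ ≠ 0 := norm_ne_zero_iff.2 hw
    rw [invert, norm_invert, invert, smul_smul]
    field_simp
    simp

theorem invert_ne_zero {w : E3} (hw : w ≠ 0) : invert w ≠ 0 := by
  rw [← norm_ne_zero_iff, norm_invert]
  simpa using hw

theorem continuousAt_invert {w : E3} (hw : w ≠ 0) : ContinuousAt invert w := by
  have : ‖w‖ ^ 2 ≠ 0 := by simpa using hw
  unfold invert
  fun_prop (disch := assumption)

theorem norm_sub_sq_of_norm_eq_one {a : E3} (ha : ‖a‖ = 1) (w : E3) :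
    ‖w - a‖ ^ 2 = 1 + (‖w‖ ^ 2 - 2 * inner ℝ w a) := by
  rw [norm_sub_sq_real, ha]; ring

theorem norm_sub_le_one_iff {a : E3} (ha : ‖a‖ = 1) (w : E3) :
    ‖w - a‖ ≤ 1 ↔ ‖w‖ ^ 2 ≤ 2 * inner ℝ w a := by
  rw [← sq_le_one_iff₀ (norm_nonneg _), norm_sub_sq_of_norm_eq_one ha]
  constructor <;> intro h <;> linarith

theorem norm_invert_sub_sq {a w : E3} (ha : ‖a‖ = 1) (hw : w ≠ 0) :
    ‖invert w - a‖ ^ 2 = 1 + 2 * (‖w‖ ^ 2)⁻¹ * (1 / 2 - inner ℝ w a) := by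
  have : ‖w‖ ≠ 0 := norm_ne_zero_iff.2 hw
  rw [norm_sub_sq_of_norm_eq_one ha, norm_invert, invert, real_inner_smul_left]
  field_simp

theorem norm_invert_sub_le_one_iff {a w : E3} (ha : ‖a‖ = 1) (hw : w ≠ 0) :
    ‖invert w - a‖ ≤ 1 ↔ 1 / 2 ≤ inner ℝ w a := by
  have : 0 < (‖w‖ ^ 2)⁻¹ := by positivity
  rw [← sq_le_one_iff₀ (norm_nonneg _), norm_invert_sub_sq ha hw]
  constructor <;> intro h
  · by_contra! h'
    have := mul_pos this (sub_pos.2 h')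
    linarith
  · have := mul_nonneg this.le (sub_nonneg.2 h)
    linarith

theorem norm_invert_sub_lt_one_iff {a w : E3} (ha : ‖a‖ = 1) (hw : w ≠ 0) :
    ‖invert w - a‖ < 1 ↔ 1 / 2 < inner ℝ w a := by
  have : 0 < (‖w‖ ^ 2)⁻¹ := by positivity
  rw [← sq_lt_one_iff₀ (norm_nonneg _), norm_invert_sub_sq ha hw]
  constructor <;> intro h
  · by_contra! h'
    have := mul_nonneg this.le (sub_nonneg.2 h')
    linarith
  · have := mul_pos this (sub_pos.2 h)
    linarith

theorem norm_invert_sub_eq_one_iff {a w : E3} (ha : ‖a‖ = 1) (hw : w ≠ 0) :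
    ‖invert w - a‖ = 1 ↔ inner ℝ w a = 1 / 2 := by
  rw [eq_iff_le_not_lt, norm_invert_sub_le_one_iff ha hw, norm_invert_sub_lt_one_iff ha hw, not_lt,
    le_antisymm_iff, and_comm]

/-! ### The circle through a point of two unit spheres -/

/-- Two unit vectors that are linearly independent. -/
structure IsUnitPair (a b : E3) : Prop where
  left : ‖a‖ = 1
  right : ‖b‖ = 1
  gt : -1 < (inner ℝ a b : ℝ)
  lt : (inner ℝ a b : ℝ) < 1

theorem IsUnitPair.symm {a b : E3} (h : IsUnitPair a b) : IsUnitPair b a :=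
  ⟨h.right, h.left, by rw [real_inner_comm]; exact h.gt, by rw [real_inner_comm]; exact h.lt⟩

theorem IsUnitPair.cross_pos {a b : E3} (h : IsUnitPair a b) :
    0 < (inner ℝ (cross a b) (cross a b) : ℝ) := by
  rw [inner_cross_self, real_inner_self_eq_norm_sq, real_inner_self_eq_norm_sq, h.left, h.right]
  nlinarith [h.gt, h.lt]

/-- The point nearest to the origin on the line `⟪w, a⟫ = ⟪w, b⟫ = 1 / 2`. -/
noncomputable def base (a b : E3) : E3 := (2 * (1 + inner ℝ a b : ℝ))⁻¹ • (a + b)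

/-- The line `⟪w, a⟫ = ⟪w, b⟫ = 1 / 2`. -/
noncomputable def line (a b : E3) (s : ℝ) : E3 := base a b + s • cross a b

theorem line_swap (a b : E3) (s : ℝ) : line b a s = line a b (-s) := by
  simp [line, base, cross_swap a b, real_inner_comm a b, add_comm a b]

theorem inner_line (a b c : E3) (s : ℝ) :
    inner ℝ (line a b s) c = inner ℝ (base a b) c + s * det3 a b c := by
  rw [line, inner_add_left, real_inner_smul_left, det3]

theorem inner_base_cross (a b : E3) : inner ℝ (base a b) (cross a b) = 0 := by
  rw [base, real_inner_smul_left, inner_add_left, real_inner_comm (cross a b) a, inner_cross_left,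
    real_inner_comm (cross a b) b, inner_cross_right]
  simp

section

variable {a b : E3}

theorem IsUnitPair.inner_line_left (h : IsUnitPair a b) (s : ℝ) :
    inner ℝ (line a b s) a = 1 / 2 := by
  have : 1 + inner ℝ a b ≠ (0 : ℝ) := by linarith [h.gt]
  rw [inner_line, det3, inner_cross_left, base, real_inner_smul_left, inner_add_left,
    real_inner_self_eq_norm_sq, h.left, real_inner_comm a b]
  field_simp
  ring

theorem IsUnitPair.inner_line_right (h : IsUnitPair a b) (s : ℝ) :
    inner ℝ (line a b s) b = 1 / 2 := by
  have := h.symm.inner_line_left (-s)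
  rwa [line_swap, neg_neg] at this

theorem IsUnitPair.line_ne_zero (h : IsUnitPair a b) (s : ℝ) : line a b s ≠ 0 := by
  intro h0
  have := h.inner_line_left s
  simp [h0] at this

theorem inner_line_cross (s : ℝ) :
    inner ℝ (line a b s) (cross a b) = s * inner ℝ (cross a b) (cross a b) := by
  rw [inner_line, inner_base_cross, zero_add, det3]

theorem IsUnitPair.eq_line (h : IsUnitPair a b) {w : E3} (ha : inner ℝ w a = 1 / 2)
    (hb : inner ℝ w b = 1 / 2) :
    w = line a b (inner ℝ w (cross a b) / inner ℝ (cross a b) (cross a b)) := by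
  have h0 := h.cross_pos.ne'
  have hla := h.inner_line_left 0
  have hlb := h.inner_line_right 0
  have hl : line a b 0 = base a b := by simp [line]
  rw [hl] at hla hlb
  have key := smul_cross_eq_of_orthogonal (a := a) (b := b) (v := w - base a b)
    (by rw [inner_sub_left, ha, hla, sub_self]) (by rw [inner_sub_left, hb, hlb, sub_self])
  rw [inner_sub_left, inner_base_cross, sub_zero] at key
  rw [line, ← sub_eq_iff_eq_add', div_eq_inv_mul, mul_smul, ← key, smul_smul,
    inv_mul_cancel₀ h0, one_smul]

theorem continuous_line (a b : E3) : Continuous (line a b) := by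
  unfold line; fun_prop

theorem IsUnitPair.tendsto_invert_line (h : IsUnitPair a b) :
    Tendsto (fun s => invert (line a b s)) atTop (𝓝 0) := by
  rw [tendsto_zero_iff_norm_tendsto_zero]
  simp_rw [norm_invert]
  apply Tendsto.inv_tendsto_atTop
  have hc : 0 < ‖cross a b‖ := by
    have := h.cross_pos
    rw [real_inner_self_eq_norm_sq] at this
    by_contra! h'
    simp [le_antisymm h' (norm_nonneg _)] at this
  refine tendsto_atTop_mono (f := fun s => s * ‖cross a b‖ - ‖base a b‖) (fun s => ?_) ?_
  · have h1 := norm_sub_le (line a b s) (base a b)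
    rw [line, add_sub_cancel_left, norm_smul] at h1
    have h2 := mul_le_mul_of_nonneg_right (le_abs_self s) hc.le
    rw [Real.norm_eq_abs] at h1
    rw [line]
    linarith
  · exact tendsto_atTop_add_const_right _ _ (tendsto_id.atTop_mul_const hc)

/-- The square of the norm of the base point is the coefficient in its definition. -/
theorem IsUnitPair.norm_base_sq (h : IsUnitPair a b) :
    ‖base a b‖ ^ 2 = (2 * (1 + inner ℝ a b : ℝ))⁻¹ := by
  have : 1 + inner ℝ a b ≠ (0 : ℝ) := by linarith [h.gt]
  have hla := h.inner_line_left 0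
  have hlb := h.inner_line_right 0
  have hl : line a b 0 = base a b := by simp [line]
  rw [hl] at hla hlb
  rw [← real_inner_self_eq_norm_sq]
  nth_rw 2 [base]
  rw [real_inner_smul_right, inner_add_right, hla, hlb]
  norm_num

/-- If the point of the circle that is farthest from the origin has distance at most `1` from it,
then the whole lens does. -/
theorem IsUnitPair.norm_le_one (h : IsUnitPair a b) (hbase : ‖invert (base a b)‖ ≤ 1) {w : E3}
    (ha : ‖w - a‖ ≤ 1) (hb : ‖w - b‖ ≤ 1) : ‖w‖ ≤ 1 := by
  rw [norm_sub_le_one_iff h.left] at ha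
  rw [norm_sub_le_one_iff h.right] at hb
  have hsq := h.norm_base_sq
  have hl : line a b 0 = base a b := by simp [line]
  have hne := h.line_ne_zero 0
  rw [hl, ← norm_pos_iff] at hne
  rw [norm_invert, inv_le_one₀ hne] at hbase
  -- Adding the two lens inequalities gives `‖w‖ ^ 2 ≤ ⟪w, a + b⟫`; Cauchy–Schwarz against the base
  -- point then bounds `‖w‖ * ‖base a b‖` by 1.
  have hcs := real_inner_le_norm w (base a b)
  rw [base, real_inner_smul_right, inner_add_right, ← base, ← hsq] at hcs
  have h1 : ‖base a b‖ ^ 2 * ‖w‖ ^ 2 ≤ ‖w‖ * ‖base a b‖ :=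
    le_trans (mul_le_mul_of_nonneg_left (by linarith) (by positivity)) hcs
  by_contra! hw
  have h2 : 1 < ‖w‖ * ‖base a b‖ := by nlinarith
  nlinarith

end

/-! ### The points of `V` at distance `1` from a point -/

/-- The points of `V` at distance exactly `1` from `x`. -/
def touching (V : Set E3) (x : E3) : Set E3 := {v | v ∈ V ∧ dist v x = 1}

variable {V : Set E3} {x p q r : E3}

theorem norm_sub_of_mem_touching (hp : p ∈ touching V x) : ‖p - x‖ = 1 := by
  rw [← dist_eq_norm, hp.2]

theorem setOf_mem_facet (hx : x ∈ ballSet V) : {p | p ∈ V ∧ x ∈ facet V p} = touching V x := by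
  ext p
  simp [facet, touching, hx, dist_comm x p]

theorem mem_ballSet_of_mem_vert (hx : x ∈ vert V) : x ∈ ballSet V := by
  rcases hx with hx | hx
  · by_contra h
    have : {p | p ∈ V ∧ x ∈ facet V p} = ∅ := by
      ext p; simp [facet, h]
    simp [principalVertices, this] at hx
  · exact hx.1.2

theorem mem_vert_iff (hx : x ∈ ballSet V) :
    x ∈ vert V ↔ 3 ≤ (touching V x).encard ∨ x ∈ V ∧ (touching V x).encard = 2 := by
  simp only [vert, principalVertices, danglingVertices, Set.mem_union, Set.mem_ofPred_eq,
    setOf_mem_facet hx, Set.mem_inter_iff, hx, and_true]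

theorem two_le_encard_touching (hx : x ∈ vert V) : 2 ≤ (touching V x).encard := by
  rcases (mem_vert_iff (mem_ballSet_of_mem_vert hx)).1 hx with h | h
  · exact le_trans (by norm_num) h
  · exact h.2.ge

theorem exists_dist_lt_one (hV : IsTight V) : ∃ c, ∀ v ∈ V, dist v c < 1 := by
  obtain ⟨R, hR⟩ := (Metric.isBounded_iff_subset_closedBall (0 : E3)).1 hV.finite.isBounded
  obtain ⟨r, ⟨-, c, hc⟩, hr⟩ := exists_lt_of_csInf_lt
    (s := {r : ℝ | 0 ≤ r ∧ ∃ c : E3, V ⊆ Metric.closedBall c r})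
    ⟨max R 0, le_max_right _ _, 0,
      hR.trans (Metric.closedBall_subset_closedBall (le_max_left _ _))⟩
    hV.circumradius_lt_one
  exact ⟨c, fun v hv => (Metric.mem_closedBall.1 (hc hv)).trans_lt hr⟩

/-- If `c` is at distance less than 1 from all of `V`, then `2⟪c - x, p - x⟫ = ‖c - x‖² + 1 - ‖c -
p‖² > 0`. -/
theorem exists_inner_pos (hV : IsTight V) (x : E3) :
    ∃ d : E3, ∀ p ∈ touching V x, 0 < (inner ℝ d (p - x) : ℝ) := by
  obtain ⟨c, hc⟩ := exists_dist_lt_one hV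
  refine ⟨c - x, fun p hp => ?_⟩
  have h1 := norm_sub_sq_of_norm_eq_one (norm_sub_of_mem_touching hp) (c - x)
  have h2 := hc p hp.1
  rw [dist_comm, dist_eq_norm] at h2
  rw [sub_sub_sub_cancel_right] at h1
  have h3 := (sq_lt_one_iff₀ (norm_nonneg _)).2 h2
  nlinarith [sq_nonneg ‖c - x‖]

theorem exists_one_lt_dist (hV : IsTight V) (hp : p ∈ V) :
    ∃ y, 1 < dist y p ∧ ∀ v ∈ V, v ≠ p → dist y v ≤ 1 := by
  have h : p ∈ ess V := hV.eq_ess ▸ hp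
  obtain ⟨y, hy, hy'⟩ := Set.exists_of_ssubset h.2
  refine ⟨y, ?_, fun v hv hvp => hy v ⟨hv, by simpa using hvp⟩⟩
  by_contra! hyp
  refine hy' fun v hv => ?_
  by_cases hvp : v = p
  · rwa [hvp]
  · exact hy v ⟨hv, by simpa using hvp⟩

/-- Every touching direction spans an extreme ray of the cone of the touching directions. -/
theorem exists_support (hV : IsTight V) (hp : p ∈ touching V x) :
    ∃ e : E3, (inner ℝ e (p - x) : ℝ) = 0 ∧
      ∀ q ∈ touching V x, q ≠ p → 0 < (inner ℝ e (q - x) : ℝ) := by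
  obtain ⟨d, hd⟩ := exists_inner_pos hV x
  obtain ⟨y, hyp, hy⟩ := exists_one_lt_dist hV hp.1
  have hp1 := norm_sub_of_mem_touching hp
  have hN : ∀ q ∈ touching V x, q ≠ p → ‖y - x‖ ^ 2 ≤ 2 * inner ℝ (y - x) (q - x) := by
    intro q hq hqp
    rw [← norm_sub_le_one_iff (norm_sub_of_mem_touching hq), sub_sub_sub_cancel_right,
      ← dist_eq_norm]
    exact hy q hq.1 hqp
  have hα : 2 * inner ℝ (y - x) (p - x) < ‖y - x‖ ^ 2 := by
    by_contra! h
    rw [← norm_sub_le_one_iff hp1, sub_sub_sub_cancel_right, ← dist_eq_norm] at h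
    linarith
  have hpos : 0 < ‖y - x‖ := by
    rw [norm_pos_iff, sub_ne_zero]
    rintro rfl
    rw [dist_comm] at hyp
    linarith [hp.2]
  -- The functional `2(y - x)` is at least `‖y - x‖²` on the other directions and equals `α < ‖y -
  -- x‖²` on `p - x`. It is corrected to vanish there: by subtracting `α(p - x)` if `α ≥ 0`, by
  -- adding a multiple of `d` if `α ≤ 0`.
  set α : ℝ := 2 * inner ℝ (y - x) (p - x) with hα'
  rcases le_total 0 α with h0 | h0
  · refine ⟨(2 : ℝ) • (y - x) - α • (p - x), ?_, fun q hq hqp => ?_⟩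
    · rw [inner_sub_left, real_inner_smul_left, real_inner_smul_left, real_inner_self_eq_norm_sq,
        hp1, ← hα']
      ring
    · rw [inner_sub_left, real_inner_smul_left, real_inner_smul_left]
      have h1 := real_inner_le_norm (p - x) (q - x)
      rw [hp1, norm_sub_of_mem_touching hq, mul_one] at h1
      linarith [hN q hq hqp, mul_le_mul_of_nonneg_left h1 h0]
  · have hdp := hd p hp
    refine ⟨(2 : ℝ) • (y - x) + (-α / inner ℝ d (p - x)) • d, ?_, fun q hq hqp => ?_⟩
    · rw [inner_add_left, real_inner_smul_left, real_inner_smul_left, ← hα',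
        div_mul_cancel₀ _ hdp.ne']
      ring
    · rw [inner_add_left, real_inner_smul_left, real_inner_smul_left]
      have h1 : 0 ≤ -α / inner ℝ d (p - x) := div_nonneg (neg_nonneg.2 h0) hdp.le
      have := mul_nonneg h1 (hd q hq).le
      linarith [hN q hq hqp, pow_pos hpos 2]

theorem isUnitPair (hV : IsTight V) (hp : p ∈ touching V x) (hq : q ∈ touching V x)
    (hpq : p ≠ q) : IsUnitPair (p - x) (q - x) := by
  have h1 := norm_sub_of_mem_touching hp
  have h2 := norm_sub_of_mem_touching hq
  refine ⟨h1, h2, lt_of_le_of_ne ?_ fun h => ?_, lt_of_le_of_ne ?_ fun h => ?_⟩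
  · have := neg_le_of_abs_le (abs_real_inner_le_norm (p - x) (q - x))
    simpa [h1, h2] using this
  · obtain ⟨d, hd⟩ := exists_inner_pos hV x
    have h3 : p - x = -(q - x) := by
      rw [eq_neg_iff_add_eq_zero, ← norm_eq_zero, ← sq_eq_zero_iff, norm_add_sq_real, h1, h2, ← h]
      norm_num
    have h4 := hd p hp
    rw [h3, inner_neg_right] at h4
    linarith [hd q hq]
  · have := real_inner_le_norm (p - x) (q - x)
    simpa [h1, h2] using this
  · exact hpq (sub_left_injective ((inner_eq_one_iff_of_norm_eq_one h1 h2).1 h))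

theorem det3_touching_ne_zero (hV : IsTight V) (hp : p ∈ touching V x) (hq : q ∈ touching V x)
    (hr : r ∈ touching V x) (hpq : p ≠ q) (hrp : r ≠ p) (hrq : r ≠ q) :
    det3 (p - x) (q - x) (r - x) ≠ 0 := by
  obtain ⟨e, he, he'⟩ := exists_support hV hp
  obtain ⟨f, hf, hf'⟩ := exists_support hV hq
  obtain ⟨g, hg, hg'⟩ := exists_support hV hr
  exact det3_ne_zero (isUnitPair hV hp hq hpq).cross_pos he (he' q hq hpq.symm) (he' r hr hrp)
    hf (hf' p hp hpq) (hf' r hr hrq) hg (hg' p hp hrp.symm) (hg' q hq hrq.symm)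

/-- The ray in the direction of the cross product of `p - x` and `q - x` is an extreme ray of the
cone of the directions that point into the ball set at `x`. -/
structure IsGerm (V : Set E3) (x p q : E3) : Prop where
  left : p ∈ touching V x
  right : q ∈ touching V x
  ne : p ≠ q
  det3_pos : ∀ r ∈ touching V x, r ≠ p → r ≠ q → 0 < det3 (p - x) (q - x) (r - x)

theorem IsGerm.right_unique {q' : E3} (h : IsGerm V x p q) (h' : IsGerm V x p q') : q = q' := by
  by_contra hne
  have h1 := h.det3_pos q' h'.right h'.ne.symm (Ne.symm hne)
  have h2 := h'.det3_pos q h.right h.ne.symm hne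
  rw [det3_swap_right] at h2
  linarith

/-- By `det3_trans`, with a functional supporting the cone along `p - x`, the sign of `det3 (p - x)`
linearly orders the other touching directions; `q` is the first one. -/
theorem exists_isGerm (hV : IsTight V) (hp : p ∈ touching V x)
    (h2 : 2 ≤ (touching V x).encard) : ∃ q, IsGerm V x p q := by
  obtain ⟨e, he, he'⟩ := exists_support hV hp
  suffices h : ∀ s : Finset E3, s.Nonempty → (∀ q ∈ s, q ∈ touching V x ∧ q ≠ p) →
      ∃ q ∈ s, ∀ r ∈ s, r ≠ q → 0 < det3 (p - x) (q - x) (r - x) by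
    have hfin : (touching V x \ {p}).Finite := (hV.finite.subset fun v hv => hv.1).sdiff
    obtain ⟨q₀, hq₀, hq₀p⟩ := Set.exists_ne_of_one_lt_encard
      (lt_of_lt_of_le (by norm_num) h2) p
    obtain ⟨q, hq, hmin⟩ := h hfin.toFinset ⟨q₀, by simp [hq₀, hq₀p]⟩ (by simp)
    rw [Set.Finite.mem_toFinset] at hq
    exact ⟨q, hp, hq.1, Ne.symm hq.2, fun r hr hrp hrq => hmin r (by simp [hr, hrp]) hrq⟩
  intro s hs
  induction hs using Finset.Nonempty.cons_induction with
  | singleton a => exact fun _ => ⟨a, by simp, by simp⟩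
  | cons a s has hs ih =>
    intro hmem
    obtain ⟨q, hqs, hq⟩ := ih fun q hq => hmem q (Finset.mem_cons_of_mem hq)
    obtain ⟨hq1, hqp⟩ := hmem q (Finset.mem_cons_of_mem hqs)
    obtain ⟨ha1, hap⟩ := hmem a (Finset.mem_cons_self a s)
    have haq : a ≠ q := fun h => has (h ▸ hqs)
    rcases (det3_touching_ne_zero hV hp hq1 ha1 hqp.symm hap haq).lt_or_gt with h | h
    · have haq' : 0 < det3 (p - x) (a - x) (q - x) := by
        rw [det3_swap_right]; linarith
      refine ⟨a, Finset.mem_cons_self a s, fun r hr hra => ?_⟩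
      have hrs := (Finset.mem_cons.1 hr).resolve_left hra
      by_cases hrq : r = q
      · rwa [hrq]
      · obtain ⟨hr1, hrp⟩ := hmem r hr
        exact det3_trans he (he' a ha1 hap) (he' q hq1 hqp) (he' r hr1 hrp) haq' (hq r hrs hrq)
    · refine ⟨q, Finset.mem_cons_of_mem hqs, fun r hr hrq => ?_⟩
      rcases Finset.mem_cons.1 hr with rfl | hrs
      · exact h
      · exact hq r hrs hrq

variable {y : E3} {s : ℝ}

/-! ### The arc -/

/-- The parametrization by the real line of the circle of the points at distance `1` from `p` and
`q`, without its point `x`. -/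
noncomputable def arc (x p q : E3) (s : ℝ) : E3 := x + invert (line (p - x) (q - x) s)

/-- The inverse of the parametrization `arc`. -/
noncomputable def param (x p q y : E3) : ℝ :=
  inner ℝ (invert (y - x)) (cross (p - x) (q - x)) /
    inner ℝ (cross (p - x) (q - x)) (cross (p - x) (q - x))

theorem arc_swap (x p q : E3) (s : ℝ) : arc x q p s = arc x p q (-s) := by
  rw [arc, line_swap, ← arc]

theorem dist_arc (r : E3) :
    dist (arc x p q s) r = ‖invert (line (p - x) (q - x) s) - (r - x)‖ := by
  rw [dist_eq_norm, arc]; congr 1; abel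

theorem continuousAt_param (hy : y ≠ x) : ContinuousAt (param x p q) y := by
  have h1 : ContinuousAt (fun y => invert (y - x)) y :=
    ContinuousAt.comp (f := fun y => y - x) (continuousAt_invert (sub_ne_zero.2 hy)) (by fun_prop)
  exact (h1.inner continuousAt_const).div_const _

section

variable (h : IsUnitPair (p - x) (q - x))
include h

theorem dist_arc_left (s : ℝ) : dist (arc x p q s) p = 1 := by
  rw [dist_arc, norm_invert_sub_eq_one_iff h.left (h.line_ne_zero s), h.inner_line_left]

theorem dist_arc_right (s : ℝ) : dist (arc x p q s) q = 1 := by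
  rw [dist_arc, norm_invert_sub_eq_one_iff h.right (h.line_ne_zero s), h.inner_line_right]

theorem arc_ne (s : ℝ) : arc x p q s ≠ x := by
  simpa [arc] using invert_ne_zero (h.line_ne_zero s)

theorem continuous_arc : Continuous (arc x p q) := by
  refine continuous_const.add (continuous_iff_continuousAt.2 fun s => ?_)
  exact ContinuousAt.comp (f := line (p - x) (q - x)) (continuousAt_invert (h.line_ne_zero s))
    (continuous_line _ _).continuousAt

theorem tendsto_arc : Tendsto (arc x p q) atTop (𝓝 x) := by
  have := h.tendsto_invert_line.const_add x
  rwa [add_zero] at this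

theorem param_arc (s : ℝ) : param x p q (arc x p q s) = s := by
  rw [param, arc, add_sub_cancel_left, invert_invert, inner_line_cross,
    mul_div_cancel_right₀ _ h.cross_pos.ne']

theorem arc_param (hp : dist y p = 1) (hq : dist y q = 1) (hy : y ≠ x) :
    arc x p q (param x p q y) = y := by
  have h0 : invert (y - x) ≠ 0 := invert_ne_zero (sub_ne_zero.2 hy)
  have h1 : ∀ r, dist y r = ‖invert (invert (y - x)) - (r - x)‖ := fun r => by
    rw [invert_invert, sub_sub_sub_cancel_right, dist_eq_norm]
  rw [h1, norm_invert_sub_eq_one_iff h.left h0] at hp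
  rw [h1, norm_invert_sub_eq_one_iff h.right h0] at hq
  rw [arc, param, ← h.eq_line hp hq, invert_invert, add_sub_cancel]

theorem dist_arc_le_one_iff (hr : ‖r - x‖ = 1) : dist (arc x p q s) r ≤ 1 ↔
    1 / 2 ≤ inner ℝ (base (p - x) (q - x)) (r - x) + s * det3 (p - x) (q - x) (r - x) := by
  rw [dist_arc, norm_invert_sub_le_one_iff hr (h.line_ne_zero s), inner_line]

theorem dist_arc_lt_one_iff (hr : ‖r - x‖ = 1) : dist (arc x p q s) r < 1 ↔
    1 / 2 < inner ℝ (base (p - x) (q - x)) (r - x) + s * det3 (p - x) (q - x) (r - x) := by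
  rw [dist_arc, norm_invert_sub_lt_one_iff hr (h.line_ne_zero s), inner_line]

/-- The infinite end of the ray contributes `x`. Any other limit point lies on the circle, where
`param` is continuous and pulls it back to `Ici a`. -/
theorem closure_arc_image_Ioi (a : ℝ) :
    closure (arc x p q '' Ioi a) = insert x (arc x p q '' Ici a) := by
  apply Subset.antisymm
  · intro y hy
    rcases eq_or_ne y x with rfl | hyx
    · exact mem_insert _ _
    have hclosed : IsClosed {y : E3 | dist y p = 1 ∧ dist y q = 1} :=
      (isClosed_eq (by fun_prop) (by fun_prop)).inter (isClosed_eq (by fun_prop) (by fun_prop))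
    have hsub : arc x p q '' Ioi a ⊆ {y : E3 | dist y p = 1 ∧ dist y q = 1} := by
      rintro _ ⟨s, -, rfl⟩
      exact ⟨dist_arc_left h s, dist_arc_right h s⟩
    obtain ⟨hp, hq⟩ := closure_minimal hsub hclosed hy
    refine mem_insert_of_mem _ ⟨param x p q y, ?_, arc_param h hp hq hyx⟩
    have h1 := (continuousAt_param (p := p) (q := q) hyx).continuousWithinAt.mem_closure_image hy
    rw [image_image] at h1
    simpa [param_arc h] using h1
  · rw [insert_subset_iff]
    refine ⟨mem_closure_of_tendsto (tendsto_arc h)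
      ((eventually_gt_atTop a).mono fun s hs => mem_image_of_mem _ hs), ?_⟩
    rw [← closure_Ioi a]
    exact image_closure_subset_closure_image (continuous_arc h)

end

/-! ### The relative interior of an edge -/

/-- The points of two facets that are not vertices. -/
def openEdge (V : Set E3) (p q : E3) : Set E3 := (facet V p ∩ facet V q) \ vert V

theorem openEdge_comm (V : Set E3) (p q : E3) : openEdge V p q = openEdge V q p := by
  rw [openEdge, openEdge, inter_comm]

theorem touching_of_mem_openEdge (hp : p ∈ V) (hq : q ∈ V) (hpq : p ≠ q)
    (hy : y ∈ openEdge V p q) : touching V y = {p, q} := by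
  obtain ⟨⟨⟨hyV, hyp⟩, -, hyq⟩, hvert⟩ := hy
  have hsub : {p, q} ⊆ touching V y := by
    rintro r (rfl | rfl)
    · exact ⟨hp, by rwa [dist_comm]⟩
    · exact ⟨hq, by rwa [dist_comm]⟩
  refine (Set.Finite.eq_of_subset_of_encard_le (by simp) hsub ?_).symm
  rw [mem_vert_iff hyV, not_or, not_le] at hvert
  rw [Set.encard_pair hpq]
  exact Order.le_of_lt_add_one hvert.1

/-- On the circle, being a non-vertex of the ball set is thus an open condition. The clause `y ∉ V`
excludes dangling vertices. -/
theorem mem_openEdge_iff (hp : p ∈ V) (hq : q ∈ V) (hpq : p ≠ q) (hyp : dist y p = 1)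
    (hyq : dist y q = 1) :
    y ∈ openEdge V p q ↔ (∀ r ∈ V \ {p, q}, dist y r < 1) ∧ y ∉ V := by
  constructor
  · intro hy
    have ht := touching_of_mem_openEdge hp hq hpq hy
    have hyV := hy.1.1.1
    refine ⟨fun r hr => lt_of_le_of_ne (hyV r hr.1) fun h1 => hr.2 ?_, fun h => ?_⟩
    · rw [← ht]
      exact ⟨hr.1, by rwa [dist_comm]⟩
    · exact hy.2 ((mem_vert_iff hyV).2 (Or.inr ⟨h, by rw [ht, Set.encard_pair hpq]⟩))
  · rintro ⟨h1, h2⟩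
    have hyV : y ∈ ballSet V := by
      intro r hr
      by_cases hrpq : r ∈ ({p, q} : Set E3)
      · rcases hrpq with rfl | rfl
        exacts [hyp.le, hyq.le]
      · exact (h1 r ⟨hr, hrpq⟩).le
    refine ⟨⟨⟨hyV, hyp⟩, hyV, hyq⟩, fun hv => ?_⟩
    rw [mem_vert_iff hyV] at hv
    have h3 := hv.resolve_right fun h => h2 h.1
    have hsub : touching V y ⊆ {p, q} := by
      intro r hr
      by_contra hrpq
      have := h1 r ⟨hr.1, hrpq⟩
      rw [dist_comm, hr.2] at this
      exact lt_irrefl _ this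
    have h4 := h3.trans (Set.encard_le_encard hsub)
    rw [Set.encard_pair hpq] at h4
    exact absurd h4 (by norm_num)

theorem isClosed_facet (V : Set E3) (p : E3) : IsClosed (facet V p) := by
  have h1 : facet V p = (⋂ v ∈ V, {y | dist y v ≤ 1}) ∩ {y | dist y p = 1} := by
    ext y; simp [facet, ballSet]
  rw [h1]
  exact (isClosed_biInter fun v _ => isClosed_le (by fun_prop) (by fun_prop)).inter
    (isClosed_eq (by fun_prop) (by fun_prop))

section

variable (hV : IsTight V) (hp : p ∈ touching V x) (hq : q ∈ touching V x) (hpq : p ≠ q)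
include hV hp hq hpq

theorem arc_mem_openEdge_iff : arc x p q s ∈ openEdge V p q ↔
    (∀ r ∈ V \ {p, q}, dist (arc x p q s) r < 1) ∧ arc x p q s ∉ V :=
  mem_openEdge_iff hp.1 hq.1 hpq (dist_arc_left (isUnitPair hV hp hq hpq) s)
    (dist_arc_right (isUnitPair hV hp hq hpq) s)

theorem isOpen_preimage_openEdge : IsOpen (arc x p q ⁻¹' openEdge V p q) := by
  have h1 : arc x p q ⁻¹' openEdge V p q =
      arc x p q ⁻¹' ((⋂ r ∈ V \ {p, q}, {y | dist y r < 1}) ∩ Vᶜ) := by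
    ext s
    simp only [mem_preimage, arc_mem_openEdge_iff hV hp hq hpq, mem_inter_iff, mem_iInter,
      mem_compl_iff, mem_ofPred_eq]
  rw [h1]
  refine IsOpen.preimage (continuous_arc (isUnitPair hV hp hq hpq)) (IsOpen.inter ?_ ?_)
  · exact hV.finite.sdiff.isOpen_biInter fun r _ => isOpen_lt (by fun_prop) (by fun_prop)
  · exact hV.finite.isClosed.isOpen_compl

theorem exists_arc_notMem_openEdge (hx : x ∈ vert V) : ∃ s, arc x p q s ∉ openEdge V p q := by
  have hu := isUnitPair hV hp hq hpq
  by_contra! hall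
  have hle : ∀ s, ∀ r ∈ V, dist (arc x p q s) r ≤ 1 := fun s => (hall s).1.1.1
  by_cases hr : ∃ r ∈ touching V x, r ∉ ({p, q} : Set E3)
  · obtain ⟨r, hr, hrpq⟩ := hr
    rw [mem_insert_iff, mem_singleton_iff, not_or] at hrpq
    have hd := det3_touching_ne_zero hV hp hq hr hpq hrpq.1 hrpq.2
    -- A third touching point gives a nonconstant affine condition on the parameter; at this value
    -- the affine function is 0, below `1 / 2`.
    have h1 := (dist_arc_le_one_iff hu (norm_sub_of_mem_touching hr)).1
      (hle (-inner ℝ (base (p - x) (q - x)) (r - x) / det3 (p - x) (q - x) (r - x)) r hr.1)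
    rw [div_mul_cancel₀ _ hd] at h1
    norm_num at h1
  · push Not at hr
    have hx2 : (touching V x).encard ≤ 2 := (Set.encard_le_encard hr).trans (Set.encard_pair hpq).le
    have hxV : x ∈ V := by
      rcases (mem_vert_iff (mem_ballSet_of_mem_vert hx)).1 hx with h | h
      · exact absurd (h.trans hx2) (by norm_num)
      · exact h.1
    -- Now `x` is dangling. Were the point of the circle farthest from `x` within distance 1 of it,
    -- the whole lens would be, including the witness `y` that `x` is essential.
    obtain ⟨y, hyx, hy⟩ := exists_one_lt_dist hV hxV
    have hne : ∀ r ∈ touching V x, r ≠ x := by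
      rintro r hr rfl
      simpa using hr.2
    have h0 := hle 0 x hxV
    rw [dist_arc, sub_self, sub_zero, line, zero_smul, add_zero] at h0
    have := hu.norm_le_one h0 (w := y - x)
      (by rw [sub_sub_sub_cancel_right, ← dist_eq_norm]; exact hy p hp.1 (hne p hp))
      (by rw [sub_sub_sub_cancel_right, ← dist_eq_norm]; exact hy q hq.1 (hne q hq))
    rw [← dist_eq_norm] at this
    linarith

theorem IsGerm.of_Ici_subset {s : ℝ} (hs : Ici s ⊆ arc x p q ⁻¹' openEdge V p q) :
    IsGerm V x p q := by
  have hu := isUnitPair hV hp hq hpq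
  refine ⟨hp, hq, hpq, fun r hr hrp hrq => ?_⟩
  refine lt_of_le_of_ne ?_ (det3_touching_ne_zero hV hp hq hr hpq hrp hrq).symm
  by_contra! hneg
  set D := det3 (p - x) (q - x) (r - x)
  set B : ℝ := inner ℝ (base (p - x) (q - x)) (r - x)
  have h1 := (dist_arc_le_one_iff hu (norm_sub_of_mem_touching hr)).1
    ((hs (le_max_left s (-B / D))).1.1.1 r hr.1)
  have h2 := mul_le_mul_of_nonpos_right (le_max_right s (-B / D)) hneg.le
  rw [div_mul_cancel₀ _ hneg.ne] at h2
  have h3 : 1 / 2 ≤ B + max s (-B / D) * D := h1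
  linarith

end

/-- Balls with `x` in their interior contain the arc near `x`; for the other touching points the
affine condition has positive slope. -/
theorem IsGerm.eventually (hV : IsTight V) (hx : x ∈ ballSet V) (hg : IsGerm V x p q) :
    ∀ᶠ s in atTop, arc x p q s ∈ openEdge V p q := by
  have hu := isUnitPair hV hg.left hg.right hg.ne
  have ht := tendsto_arc hu
  simp only [arc_mem_openEdge_iff hV hg.left hg.right hg.ne]
  refine Eventually.and ?_ ?_
  · refine (Filter.eventually_all_finite hV.finite.sdiff).2 fun r hr => ?_
    have hrpq := hr.2
    rw [mem_insert_iff, mem_singleton_iff, not_or] at hrpq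
    rcases (hx r hr.1).lt_or_eq with h | h
    · exact (ht.dist tendsto_const_nhds).eventually (gt_mem_nhds h)
    · have hr' : r ∈ touching V x := ⟨hr.1, by rwa [dist_comm]⟩
      simp only [dist_arc_lt_one_iff hu (norm_sub_of_mem_touching hr')]
      exact (tendsto_atTop_add_const_left _ _ (tendsto_id.atTop_mul_const
        (hg.det3_pos r hr' hrpq.1 hrpq.2))).eventually_gt_atTop _
  · have h1 : (V \ {x})ᶜ ∈ 𝓝 x := hV.finite.sdiff.isClosed.isOpen_compl.mem_nhds (by simp)
    filter_upwards [ht.eventually h1] with s hs hsV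
    exact hs ⟨hsV, arc_ne hu s⟩

/-- The set of parameters that follow a germ up to the next vertex is an open ray. -/
theorem IsGerm.exists_Ioi (hV : IsTight V) (hx : x ∈ vert V) (hg : IsGerm V x p q) :
    ∃ a, arc x p q a ∉ openEdge V p q ∧ ∀ s, a < s → arc x p q s ∈ openEdge V p q := by
  set C := (arc x p q ⁻¹' openEdge V p q)ᶜ with hC
  obtain ⟨M, hM⟩ := eventually_atTop.1 (hg.eventually hV (mem_ballSet_of_mem_vert hx))
  have hne : C.Nonempty := exists_arc_notMem_openEdge hV hg.left hg.right hg.ne hx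
  have hbdd : BddAbove C := ⟨M, fun s hs => by
    by_contra! h
    exact hs (hM s h.le)⟩
  have hclosed : IsClosed C :=
    (isOpen_preimage_openEdge hV hg.left hg.right hg.ne).isClosed_compl
  -- The last parameter outside the open edge.
  refine ⟨sSup C, hclosed.csSup_mem hne hbdd, fun s hs => ?_⟩
  by_contra h
  exact (le_csSup hbdd h).not_gt hs

/-- `param` maps the component to an interval that contains `s` and omits `a`. -/
theorem IsGerm.connectedComponentIn_openEdge (hV : IsTight V) (hx : x ∈ vert V)
    (hg : IsGerm V x p q) {a : ℝ} (ha : arc x p q a ∉ openEdge V p q)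
    (h : ∀ s, a < s → arc x p q s ∈ openEdge V p q) (hs : a < s) :
    connectedComponentIn (openEdge V p q) (arc x p q s) = arc x p q '' Ioi a := by
  have hu := isUnitPair hV hg.left hg.right hg.ne
  apply Subset.antisymm
  · set K := connectedComponentIn (openEdge V p q) (arc x p q s)
    have hK : K ⊆ openEdge V p q := connectedComponentIn_subset _ _
    have hKx : ∀ y ∈ K, y ≠ x := by
      rintro y hy rfl
      exact (hK hy).2 hx
    have hKa : ∀ y ∈ K, arc x p q (param x p q y) = y := fun y hy =>
      arc_param hu (hK hy).1.1.2 (hK hy).1.2.2 (hKx y hy)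
    have hJ : IsPreconnected (param x p q '' K) :=
      isPreconnected_connectedComponentIn.image _ fun y hy =>
        (continuousAt_param (hKx y hy)).continuousWithinAt
    have hsJ : s ∈ param x p q '' K :=
      ⟨arc x p q s, mem_connectedComponentIn (h s hs), param_arc hu s⟩
    intro y hy
    refine ⟨param x p q y, ?_, hKa y hy⟩
    by_contra! hya
    obtain ⟨z, hz, hza⟩ := hJ.ordConnected.out (mem_image_of_mem _ hy) hsJ
      ⟨not_lt.1 hya, hs.le⟩
    rw [← hza, hKa z hz] at ha
    exact ha (hK hz)
  · refine IsPreconnected.subset_connectedComponentIn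
      (isPreconnected_Ioi.image _ (continuous_arc hu).continuousOn) (mem_image_of_mem _ hs) ?_
    rintro _ ⟨t, ht, rfl⟩
    exact h t ht

variable {p' q' : E3} {e e' : Set E3}

/-! ### Edges at a vertex -/

/-- The edge that leaves `x` along the germ `(p, q)`. -/
structure IsGermEdge (V : Set E3) (x p q : E3) (e : Set E3) : Prop where
  isGerm : IsGerm V x p q
  exists_eq : ∃ a, arc x p q a ∉ openEdge V p q ∧ (∀ s, a < s → arc x p q s ∈ openEdge V p q) ∧
    e = closure (arc x p q '' Ioi a)

theorem IsGerm.exists_isGermEdge (hV : IsTight V) (hx : x ∈ vert V) (hg : IsGerm V x p q) :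
    ∃ e, IsGermEdge V x p q e := by
  obtain ⟨a, ha, h⟩ := hg.exists_Ioi hV hx
  exact ⟨_, hg, a, ha, h, rfl⟩

theorem IsGermEdge.unique (h : IsGermEdge V x p q e) (h' : IsGermEdge V x p q' e') : e = e' := by
  obtain rfl := h.isGerm.right_unique h'.isGerm
  obtain ⟨a, ha, hs, rfl⟩ := h.exists_eq
  obtain ⟨b, hb, ht, rfl⟩ := h'.exists_eq
  rcases lt_trichotomy a b with hab | rfl | hab
  · exact absurd (hs b hab) hb
  · rfl
  · exact absurd (ht a hab) ha

theorem IsGermEdge.isEdge (hV : IsTight V) (hx : x ∈ vert V) (h : IsGermEdge V x p q e) :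
    IsEdge V e := by
  obtain ⟨a, ha, hs, rfl⟩ := h.exists_eq
  have hg := h.isGerm
  refine ⟨p, hg.left.1, q, hg.right.1, hg.ne, arc x p q (a + 1), hs _ (by linarith), ?_⟩
  exact congrArg closure
    (hg.connectedComponentIn_openEdge hV hx ha hs (by linarith : a < a + 1)).symm

/-- Facets are closed, so the endpoint lies on both and can only fail to be in the open edge by
being a vertex. The closed edge therefore determines its open arc. -/
theorem closure_sdiff_vert_of_isGerm (hV : IsTight V) (hx : x ∈ vert V) (hg : IsGerm V x p q)
    {a : ℝ} (ha : arc x p q a ∉ openEdge V p q) (hs : ∀ s, a < s → arc x p q s ∈ openEdge V p q) :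
    arc x p q a ∈ vert V ∧ closure (arc x p q '' Ioi a) \ vert V = arc x p q '' Ioi a := by
  have hu := isUnitPair hV hg.left hg.right hg.ne
  have hmem : arc x p q a ∈ closure (arc x p q '' Ioi a) := by
    rw [closure_arc_image_Ioi hu]
    exact mem_insert_of_mem _ (mem_image_of_mem _ self_mem_Ici)
  have hav : arc x p q a ∈ vert V := by
    by_contra hv
    refine ha ⟨closure_minimal ?_ ((isClosed_facet V p).inter (isClosed_facet V q)) hmem, hv⟩
    rintro _ ⟨s, hs', rfl⟩
    exact (hs s hs').1
  refine ⟨hav, Subset.antisymm ?_ ?_⟩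
  · rw [closure_arc_image_Ioi hu]
    rintro y ⟨rfl | ⟨s, hs', rfl⟩, hy⟩
    · exact absurd hx hy
    · refine mem_image_of_mem _ (mem_Ioi.2 (lt_of_le_of_ne hs' ?_))
      rintro rfl
      exact hy hav
  · rintro _ ⟨s, hs', rfl⟩
    exact ⟨subset_closure (mem_image_of_mem _ hs'), (hs s hs').2⟩

theorem IsGermEdge.exists_inter_vert (hV : IsTight V) (hx : x ∈ vert V)
    (h : IsGermEdge V x p q e) : ∃ y, y ≠ x ∧ e ∩ vert V = {x, y} := by
  obtain ⟨a, ha, hs, rfl⟩ := h.exists_eq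
  have hg := h.isGerm
  have hu := isUnitPair hV hg.left hg.right hg.ne
  have hav := (closure_sdiff_vert_of_isGerm hV hx hg ha hs).1
  refine ⟨arc x p q a, arc_ne hu a, ?_⟩
  rw [closure_arc_image_Ioi hu]
  apply Subset.antisymm
  · rintro y ⟨rfl | ⟨s, hs', rfl⟩, hy⟩
    · exact mem_insert _ _
    · rcases (mem_Ici.1 hs').eq_or_lt with rfl | h'
      · exact mem_insert_of_mem _ rfl
      · exact absurd hy (hs s h').2
  · rintro y (rfl | rfl)
    · exact ⟨mem_insert _ _, hx⟩
    · exact ⟨mem_insert_of_mem _ (mem_image_of_mem _ self_mem_Ici), hav⟩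

/-- Any non-vertex of the edge recovers the pair `{p, q}`. Only the germs `(p, q)` and `(q, p)`
could then share an edge, but swapping reverses the parameter, and a ray unbounded above is not one
bounded above. -/
theorem IsGermEdge.left_unique (hV : IsTight V) (hx : x ∈ vert V) (h : IsGermEdge V x p q e)
    (h' : IsGermEdge V x p' q' e) : p = p' := by
  by_contra hne
  have hg := h.isGerm
  have hg' := h'.isGerm
  obtain ⟨a, ha, hs, rfl⟩ := h.exists_eq
  obtain ⟨b, hb, ht, heq⟩ := h'.exists_eq
  have himg : arc x p q '' Ioi a = arc x p' q' '' Ioi b := by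
    rw [← (closure_sdiff_vert_of_isGerm hV hx hg ha hs).2, heq,
      (closure_sdiff_vert_of_isGerm hV hx hg' hb ht).2]
  have hpair : ({p, q} : Set E3) = {p', q'} := by
    have h1 : arc x p q (a + 1) ∈ arc x p' q' '' Ioi b :=
      himg ▸ mem_image_of_mem _ (by simp)
    obtain ⟨t, htb, hta⟩ := h1
    rw [← touching_of_mem_openEdge hg.left.1 hg.right.1 hg.ne (hs (a + 1) (by linarith)), ← hta,
      touching_of_mem_openEdge hg'.left.1 hg'.right.1 hg'.ne (ht t htb)]
  have hpq' : p = q' := by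
    have : p ∈ ({p', q'} : Set E3) := hpair ▸ mem_insert p {q}
    exact this.resolve_left hne
  have hqp' : q = p' := by
    have : p' ∈ ({p, q} : Set E3) := hpair ▸ mem_insert p' {q'}
    exact (this.resolve_left (Ne.symm hne)).symm
  subst hpq' hqp'
  have hu := isUnitPair hV hg.left hg.right hg.ne
  have h1 : arc x p q (max a (-b) + 1) ∈ arc x q p '' Ioi b :=
    himg ▸ mem_image_of_mem _ (lt_of_le_of_lt (le_max_left a (-b)) (by linarith))
  obtain ⟨t, htb, hta⟩ := h1
  rw [arc_swap] at hta
  have h2 := congrArg (param x p q) hta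
  rw [param_arc hu, param_arc hu] at h2
  linarith [le_max_right a (-b), mem_Ioi.1 htb]

/-- A component of an open edge that contains arbitrarily large parameters is a germ edge. -/
theorem isGermEdge_of_not_bddAbove (hV : IsTight V) (hx : x ∈ vert V) (hp : p ∈ touching V x)
    (hq : q ∈ touching V x) (hpq : p ≠ q) {z : E3} (hz : z ∈ openEdge V p q)
    (hub : ¬ BddAbove (param x p q '' connectedComponentIn (openEdge V p q) z)) :
    IsGermEdge V x p q (closure (connectedComponentIn (openEdge V p q) z)) := by
  have hu := isUnitPair hV hp hq hpq
  set K := connectedComponentIn (openEdge V p q) z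
  have hK : K ⊆ openEdge V p q := connectedComponentIn_subset _ _
  have hKx : ∀ y ∈ K, y ≠ x := by
    rintro y hy rfl
    exact (hK hy).2 hx
  have hKa : ∀ y ∈ K, arc x p q (param x p q y) = y := fun y hy =>
    arc_param hu (hK hy).1.1.2 (hK hy).1.2.2 (hKx y hy)
  have hJ : IsPreconnected (param x p q '' K) :=
    isPreconnected_connectedComponentIn.image _ fun y hy =>
      (continuousAt_param (hKx y hy)).continuousWithinAt
  have hzK : z ∈ K := mem_connectedComponentIn hz
  have hIci : Ici (param x p q z) ⊆ arc x p q ⁻¹' openEdge V p q := by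
    intro s hs
    obtain ⟨t, ht, hst⟩ := not_bddAbove_iff.1 hub s
    obtain ⟨y, hy, rfl⟩ := hJ.ordConnected.out (mem_image_of_mem _ hzK) ht ⟨hs, hst.le⟩
    rw [mem_preimage, hKa y hy]
    exact hK hy
  have hg := IsGerm.of_Ici_subset hV hp hq hpq hIci
  obtain ⟨a, ha, hs⟩ := hg.exists_Ioi hV hx
  have haz : a < param x p q z := by
    by_contra! h
    exact ha (hIci h)
  refine ⟨hg, a, ha, hs, congrArg closure ?_⟩
  rw [← hg.connectedComponentIn_openEdge hV hx ha hs haz, hKa z hzK]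

/-- With parameters bounded on both sides, the component would lie in a compact arc avoiding `x`,
and `x` could not be in its closure. An end unbounded below becomes unbounded above when `p` and `q`
are swapped. -/
theorem exists_isGermEdge (hV : IsTight V) (hx : x ∈ vert V) (he : IsEdge V e) (hxe : x ∈ e) :
    ∃ p q, IsGermEdge V x p q e := by
  obtain ⟨p, hp, q, hq, hpq, z, hz, rfl⟩ := he
  change z ∈ openEdge V p q at hz
  change x ∈ closure (connectedComponentIn (openEdge V p q) z) at hxe
  change ∃ p' q', IsGermEdge V x p' q' (closure (connectedComponentIn (openEdge V p q) z))
  have hK : connectedComponentIn (openEdge V p q) z ⊆ openEdge V p q :=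
    connectedComponentIn_subset _ _
  have hxF : x ∈ facet V p ∩ facet V q := closure_minimal (hK.trans sdiff_subset)
    ((isClosed_facet V p).inter (isClosed_facet V q)) hxe
  have hpx : p ∈ touching V x := ⟨hp, by rw [dist_comm]; exact hxF.1.2⟩
  have hqx : q ∈ touching V x := ⟨hq, by rw [dist_comm]; exact hxF.2.2⟩
  have hu := isUnitPair hV hpx hqx hpq
  by_cases hub : BddAbove (param x p q '' connectedComponentIn (openEdge V p q) z)
  · refine ⟨q, p, ?_⟩
    rw [openEdge_comm] at hz ⊢
    refine isGermEdge_of_not_bddAbove hV hx hqx hpx hpq.symm hz fun hub' => ?_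
    rw [openEdge_comm] at hub'
    obtain ⟨M, hM⟩ := hub
    obtain ⟨N, hN⟩ := hub'
    have hcpt : IsCompact (arc x p q '' Icc (-N) M) := isCompact_Icc.image (continuous_arc hu)
    have hsub : connectedComponentIn (openEdge V p q) z ⊆ arc x p q '' Icc (-N) M := by
      intro y hy
      have hyx : y ≠ x := by
        rintro rfl
        exact (hK hy).2 hx
      have h1 := arc_param hu (hK hy).1.1.2 (hK hy).1.2.2 hyx
      have h2 := arc_param hu.symm (hK hy).1.2.2 (hK hy).1.1.2 hyx
      refine ⟨param x p q y, ⟨?_, hM (mem_image_of_mem _ hy)⟩, h1⟩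
      have h3 : param x q p y ≤ N := hN (mem_image_of_mem _ hy)
      rw [arc_swap] at h2
      have h4 := congrArg (param x p q) h2
      rw [param_arc hu] at h4
      linarith
    obtain ⟨s, -, hs⟩ := closure_minimal hsub hcpt.isClosed hxe
    exact arc_ne hu s hs
  · exact ⟨p, q, isGermEdge_of_not_bddAbove hV hx hpx hqx hpq hz hub⟩

theorem loopSet_oneSkeleton (hV : IsTight V) (hx : x ∈ vert V) :
    (oneSkeleton V).loopSet x = ∅ := by
  refine eq_empty_of_forall_notMem fun e he => ?_
  obtain ⟨hedge, hinter⟩ : IsEdge V e ∧ e ∩ vert V = {x, x} := he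
  have hxe : x ∈ e ∩ vert V := hinter ▸ mem_insert x {x}
  obtain ⟨p, q, h⟩ := exists_isGermEdge hV hx hedge hxe.1
  obtain ⟨y, hyx, hy⟩ := h.exists_inter_vert hV hx
  have : y ∈ ({x, x} : Set E3) := by
    rw [← hinter, hy]
    exact mem_insert_of_mem _ rfl
  simp [hyx] at this

theorem encard_incidenceSet_oneSkeleton (hV : IsTight V) (hx : x ∈ vert V) :
    ((oneSkeleton V).incidenceSet x).encard = (touching V x).encard := by
  have hex : ∀ p ∈ touching V x, ∃ e q, IsGermEdge V x p q e := by
    intro p hp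
    obtain ⟨q, hg⟩ := exists_isGerm hV hp (two_le_encard_touching hx)
    obtain ⟨e, he⟩ := hg.exists_isGermEdge hV hx
    exact ⟨e, q, he⟩
  choose! f g hf using hex
  have himg : (oneSkeleton V).incidenceSet x = f '' touching V x := by
    ext e
    constructor
    · rintro ⟨y, hedge, hinter⟩
      have hxe : x ∈ e ∩ vert V := hinter ▸ mem_insert x {y}
      obtain ⟨p, q, h⟩ := exists_isGermEdge hV hx hedge hxe.1
      exact ⟨p, h.isGerm.left, (hf p h.isGerm.left).unique h⟩
    · rintro ⟨p, hp, rfl⟩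
      obtain ⟨y, -, hy⟩ := (hf p hp).exists_inter_vert hV hx
      exact ⟨y, (hf p hp).isEdge hV hx, hy⟩
  rw [himg]
  refine Set.InjOn.encard_image fun p hp p' hp' h => ?_
  exact (hf p hp).left_unique hV hx (h ▸ hf p' hp')

end BallPolytope

theorem corollary6p1 (V : Set BallPolytope.E3) (hfin : V.Finite)
    (htight : BallPolytope.IsTight V) (hcard : 3 ≤ V.encard)
    (hcr : BallPolytope.circumradius V < 1)
    (x : BallPolytope.E3) (hx : x ∈ BallPolytope.vert V) :
    BallPolytope.valence (BallPolytope.oneSkeleton V) x =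
      {v : BallPolytope.E3 | v ∈ V ∧ dist v x = 1}.encard := by
  rw [BallPolytope.valence, BallPolytope.loopSet_oneSkeleton htight hx,
    BallPolytope.encard_incidenceSet_oneSkeleton htight hx, Set.encard_empty, add_zero]
  rfl
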